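/- A 2D-QAC circuit $C$ of width $w$ and depth $d$ acts on qubits arranged in a grid with $w$ rows of some length $m$. It has the form $C = L_d M_d \cdots L_1 M_1 L_0$, where each $L_k$ is a tensor product of arbitrary single-qubit unitaries, one on each qubit, and each $M_k$ is a layer of multi-qubit $\mathrm{CZ}$ gates with pairwise disjoint supports. The support of a gate is the set of qubits on which it acts; a $\mathrm{CZ}$ gate maps $|1\cdots1\rangle$ on its support to $-|1\cdots1\rangle$ and fixes all other basis states; and every support is an interval of consecutive qubits in one row or one column. A set $I$ of $n$ of the qubits carries the input $x \in \{0,1\}^I$, in the basis state $|x\rangle$; the other qubits are ancillas, in an arbitrary fixed pure (unit) state $|a\rangle$ independent of $x$. Running $C$ on $|x\rangle \otimes |a\rangle$ and measuring a fixed output qubit in the computational basis gives a random bit $g_C(x)$. The forward light-cone of a qubit $i$ in a circuit of depth $t$ is the set of all qubits $j$ for which there is a path $i = i_0, i_1, \ldots, i_t = j$ such that for each layer $k = 1, \dots, t$ the qubits $i_{k-1}, i_k$ either coincide or lie in the support of the same $\mathrm{CZ}$ gate of layer $M_k$. The weight of a $\mathrm{CZ}$ gate of layer $M_k$ in $C$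 is the number of input qubits $i \in I$ whose forward light-cone in the circuit $L_{k-1} M_{k-1} \cdots M_1 L_0$ formed by the preceding layers meets the support of the gate. **Lemma.** Let $n, w, d \ge 1$ and $s \ge 3$ be integers, and let $C$ be a depth-$d$ width-$w$ 2D-QAC circuit with input qubits $I$, $|I| = n$. If every $\mathrm{CZ}$ gate of $C$ has weight at most $s$ and $$(2s)^w \cdot (2w+1)^{w(w-1)/2} < n^{1/d},$$ then $$\Pr_{x, C}\big[g_C(x) = \textstyle\bigoplus_{i \in I} x_i\big] = \frac12,$$ where $x$ is uniform in $\{0,1\}^I$ and the probability is over $x$ and the measurement. -/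

import Mathlib

/-- One layer of multi-qubit `CZ` gates on the qubits `Q`. A gate is given by its support, a set of
at least two qubits, and distinct gates of the layer have disjoint supports. -/
structure CZLayer (Q : Type*) where
  gates : Finset (Finset Q)
  two_le_card : ∀ T ∈ gates, 2 ≤ T.card
  pairwiseDisjoint : (gates : Set (Finset Q)).PairwiseDisjoint id

/-- A depth-`d` QAC circuit `L_d M_d ⋯ L_1 M_1 L_0` on the qubits `Q`: the layers
`L_0, …, L_d` apply a single-qubit unitary to every qubit, and the `d` layers between them consist
of multi-qubit `CZ` gates with disjoint supports. The `CZ` layer `M_{k+1}` is `cz k`. -/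
structure QACCircuit (Q : Type*) (d : ℕ) where
  single : Fin (d + 1) → Q → Matrix.unitaryGroup Bool ℂ
  cz : Fin d → CZLayer Q

/-- The matrix, in the computational basis, of the tensor product of the single-qubit unitaries
`U q`. -/
def singleLayerMatrix {Q : Type*} [Fintype Q] (U : Q → Matrix.unitaryGroup Bool ℂ) :
    Matrix (Q → Bool) (Q → Bool) ℂ :=
  Matrix.of fun x y => ∏ q, (U q : Matrix Bool Bool ℂ) (x q) (y q)

/-- The phase that the `CZ` gate with support `T` gives to the basis state `|x⟩`:
`-1` if all qubits of `T` are `1`, and `1` otherwise. -/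
def czPhase {Q : Type*} (T : Finset Q) (x : Q → Bool) : ℂ :=
  if ∀ q ∈ T, x q = true then -1 else 1

/-- The matrix of the `CZ` gate with support `T` (acting as the identity on the other qubits). -/
def czMatrix {Q : Type*} [DecidableEq Q] [Fintype Q] (T : Finset Q) :
    Matrix (Q → Bool) (Q → Bool) ℂ :=
  Matrix.diagonal (czPhase T)

/-- The matrix of a layer of `CZ` gates: the product of the diagonal matrices of its gates. -/
def czLayerMatrix {Q : Type*} [DecidableEq Q] [Fintype Q] (M : CZLayer Q) :
    Matrix (Q → Bool) (Q → Bool) ℂ :=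
  Matrix.diagonal fun x => ∏ T ∈ M.gates, czPhase T x

/-- `czLayerMatrix` is the product, in any order, of the matrices of the gates of the layer. -/
theorem czLayerMatrix_eq_prod {Q : Type*} [DecidableEq Q] [Fintype Q] (M : CZLayer Q) :
    czLayerMatrix M = (M.gates.toList.map czMatrix).prod := by
  have h : ∀ l : List (Finset Q), (l.map czMatrix).prod =
      Matrix.diagonal fun x : Q → Bool => (l.map fun T => czPhase T x).prod := by
    intro l
    induction l with
    | nil => simp
    | cons T l ih =>
      rw [List.map_cons, List.prod_cons, ih, czMatrix, Matrix.diagonal_mul_diagonal]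
      simp
  rw [h, czLayerMatrix]
  simp

namespace QACCircuit

variable {Q : Type*} {d : ℕ}

/-- The unitary `L_t M_t ⋯ L_1 M_1 L_0` of the first `t` layers of the circuit. -/
noncomputable def prefixUnitary [DecidableEq Q] [Fintype Q] (C : QACCircuit Q d) :
    Fin (d + 1) → Matrix (Q → Bool) (Q → Bool) ℂ :=
  Fin.induction (motive := fun _ => Matrix (Q → Bool) (Q → Bool) ℂ)
    (singleLayerMatrix (C.single 0))
    (fun k U => singleLayerMatrix (C.single k.succ) * czLayerMatrix (C.cz k) * U)

/-- The unitary `L_d M_d ⋯ L_1 M_1 L_0` implemented by the circuit. -/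
noncomputable def unitary [DecidableEq Q] [Fintype Q] (C : QACCircuit Q d) :
    Matrix (Q → Bool) (Q → Bool) ℂ :=
  C.prefixUnitary (Fin.last d)

/-- The qubits `a` and `b` are in the support of the same gate of layer `k`. Since a single-qubit
gate acts on every qubit, this holds whenever `a = b`. -/
def SameGate (C : QACCircuit Q d) (k : Fin d) (a b : Q) : Prop :=
  a = b ∨ ∃ T ∈ (C.cz k).gates, a ∈ T ∧ b ∈ T

/-- The forward light-cone of the qubit `i` in the circuit formed by the first `t` layers of `C`:
all qubits `j` that are reached from `i` by a path `p 0 = i, p 1, …, p t = j` in which, at each of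
the first `t` layers, consecutive qubits are in the support of the same gate. (The values of `p`
after `t` are irrelevant.) For `t = Fin.last d` it is the light-cone in the whole circuit. -/
def forwardLightCone (C : QACCircuit Q d) (t : Fin (d + 1)) (i : Q) : Set Q :=
  {j | ∃ p : Fin (d + 1) → Q, p 0 = i ∧ p t = j ∧
    ∀ k : Fin d, k.castSucc < t → C.SameGate k (p k.castSucc) (p k.succ)}

/-- The weight of a `CZ` gate with support `T` in layer `k`: the number of input qubits `i ∈ I`
whose forward light-cone, in the circuit formed by the layers before this gate, meets `T`. -/
noncomputable def weight (C : QACCircuit Q d) (I : Finset Q) (k : Fin d) (T : Finset Q) : ℕ :=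
  {i : Q | i ∈ I ∧ (C.forwardLightCone k.castSucc i ∩ (T : Set Q)).Nonempty}.ncard

/-- A circuit on `w` rows of `m` qubits each is a 2D-QAC circuit if every multi-qubit `CZ` gate acts
on an interval of consecutive qubits in one row or in one column. -/
def Is2D {w m : ℕ} (C : QACCircuit (Fin w × Fin m) d) : Prop :=
  ∀ k, ∀ T ∈ (C.cz k).gates,
    (∃ (r : Fin w) (c₁ c₂ : Fin m), T = {r} ×ˢ Finset.Icc c₁ c₂) ∨
    (∃ (r₁ r₂ : Fin w) (c : Fin m), T = Finset.Icc r₁ r₂ ×ˢ {c})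

end QACCircuit

/-- The state `|x⟩ ⊗ |a⟩`: the input qubits `I` are in the basis state `|x⟩` and the remaining
(ancilla) qubits are in the state `a`. -/
noncomputable def initialState {Q : Type*} [DecidableEq Q] [Fintype Q] (I : Finset Q)
    (a : EuclideanSpace ℂ ({q // q ∉ I} → Bool)) (x : {q // q ∈ I} → Bool) :
    (Q → Bool) → ℂ :=
  fun z => if (fun q : {q // q ∈ I} => z q) = x then a (fun q => z q) else 0

/-- The probability that measuring qubit `o` in the computational basis, after running `C` on
`|x⟩ ⊗ |a⟩`, gives the outcome `b`, i.e. `Pr[g_C(x) = b]`. -/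
noncomputable def QACCircuit.outputProb {Q : Type*} [DecidableEq Q] [Fintype Q] {d : ℕ}
    (C : QACCircuit Q d) (I : Finset Q) (a : EuclideanSpace ℂ ({q // q ∉ I} → Bool)) (o : Q)
    (x : {q // q ∈ I} → Bool) (b : Bool) : ℝ :=
  ∑ z : Q → Bool with z o = b, ‖(C.unitary.mulVec (initialState I a x)) z‖ ^ 2

/-- The parity `⊕ᵢ xᵢ` of a bit string. -/
def parity {ι : Type*} [Fintype ι] (x : ι → Bool) : Bool :=
  decide (Odd (Finset.univ.filter fun i => x i = true).card)

/-- The probability, over a uniformly random input `x` and the measurement, that the outcome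
`g_C(x)` equals the parity of `x`. -/
noncomputable def QACCircuit.paritySuccessProb {Q : Type*} [DecidableEq Q] [Fintype Q] {d : ℕ}
    (C : QACCircuit Q d) (I : Finset Q) (a : EuclideanSpace ℂ ({q // q ∉ I} → Bool)) (o : Q) : ℝ :=
  (∑ x : {q // q ∈ I} → Bool, C.outputProb I a o x (parity x)) / 2 ^ I.card

/-!
Flipping an input qubit `i` before the circuit `C` amounts to applying `C X_i C⁻¹` after it. Layer
by layer, this operator stays in the algebra of operators acting on the forward light-cone of `i`,
so if the output qubit `o` lies outside that cone the flip leaves the distribution of the output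
unchanged while it negates the parity, and the success probability is exactly `1 / 2`.

An input whose light-cone misses `o` exists for a simple reason. If `T` is the last gate acting on
`o`, then an input reaches `o` only through `T`, so a weight of `T` below the number of inputs
leaves some input out; if no gate acts on `o`, then the only input that can reach `o` is `o` itself.
-/

open scoped Matrix

section TensorMatrix

variable {ι : Type*} [Fintype ι] [DecidableEq ι] {κ : ι → Type*} [∀ i, Fintype (κ i)]
  [∀ i, DecidableEq (κ i)] {R : Type*}

/-- The tensor product `⨂ᵢ V i` of square matrices, one for each tensor factor, as a monoid
homomorphism. Its rows and columns are indexed by the choices of one basis index per factor. -/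
def tensorMatrix [CommSemiring R] :
    (∀ i, Matrix (κ i) (κ i) R) →* Matrix (∀ i, κ i) (∀ i, κ i) R where
  toFun V := Matrix.of fun x y => ∏ i, V i (x i) (y i)
  map_one' := by
    ext x y
    simp [Matrix.one_apply, Finset.prod_ite_zero, funext_iff]
  map_mul' V W := by
    ext x y
    simp only [Matrix.of_apply, Matrix.mul_apply, Pi.mul_apply, Finset.prod_univ_sum,
      Fintype.piFinset_univ, Finset.prod_mul_distrib]

section CommSemiring

variable [CommSemiring R]

theorem tensorMatrix_apply (V : ∀ i, Matrix (κ i) (κ i) R) (x y : ∀ i, κ i) :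
    tensorMatrix V x y = ∏ i, V i (x i) (y i) := rfl

theorem star_tensorMatrix [StarRing R] (V : ∀ i, Matrix (κ i) (κ i) R) :
    star (tensorMatrix V) = tensorMatrix (star V) := by
  ext x y
  simp [tensorMatrix_apply, Matrix.star_apply]

theorem tensorMatrix_diagonal (v : ∀ i, κ i → R) :
    tensorMatrix (fun i => Matrix.diagonal (v i)) =
      Matrix.diagonal fun x : ∀ i, κ i => ∏ i, v i (x i) := by
  ext x y
  simp [tensorMatrix_apply, Matrix.diagonal_apply, Finset.prod_ite_zero, funext_iff]

theorem tensorMatrix_permMatrix (σ : ∀ i, Equiv.Perm (κ i)) :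
    tensorMatrix (fun i => (σ i).permMatrix R) =
      Equiv.Perm.permMatrix R (Equiv.piCongrRight σ) := by
  ext x y
  simp [tensorMatrix_apply, PEquiv.toMatrix_apply, Finset.prod_ite_zero, funext_iff]

end CommSemiring

theorem tensorMatrix_mem_unitaryGroup [CommRing R] [StarRing R] {V : ∀ i, Matrix (κ i) (κ i) R}
    (hV : ∀ i, V i ∈ Matrix.unitaryGroup (κ i) R) :
    tensorMatrix V ∈ Matrix.unitaryGroup (∀ i, κ i) R := by
  have hV' : V * star V = 1 := funext fun i => Matrix.mem_unitaryGroup_iff.mp (hV i)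
  rw [Matrix.mem_unitaryGroup_iff, star_tensorMatrix, ← map_mul, hV', map_one]

end TensorMatrix

section LocalAlgebra

variable {ι : Type*} [Fintype ι] [DecidableEq ι] {κ : ι → Type*} [∀ i, Fintype (κ i)]
  [∀ i, DecidableEq (κ i)] {R : Type*}

variable (R) in
/-- The algebra of operators that act only on the tensor factors in `S`, generated by the product
operators that are trivial outside `S`. -/
def localAlgebra [CommSemiring R] (S : Set ι) : Subalgebra R (Matrix (∀ i, κ i) (∀ i, κ i) R) :=
  Algebra.adjoin R (tensorMatrix '' {V | ∀ i ∉ S, V i = 1})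

section CommSemiring

variable [CommSemiring R] {S T : Set ι}

theorem tensorMatrix_mem_localAlgebra {V : ∀ i, Matrix (κ i) (κ i) R} (hV : ∀ i ∉ S, V i = 1) :
    tensorMatrix V ∈ localAlgebra R S :=
  Algebra.subset_adjoin (Set.mem_image_of_mem _ hV)

theorem localAlgebra_mono (h : S ⊆ T) : localAlgebra R (κ := κ) S ≤ localAlgebra R T :=
  Algebra.adjoin_mono <| Set.image_mono fun _ hV i hi => hV i (mt (@h i) hi)

theorem commute_tensorMatrix_of_disjoint (hST : Disjoint S T) {V W : ∀ i, Matrix (κ i) (κ i) R}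
    (hV : ∀ i ∉ S, V i = 1) (hW : ∀ i ∉ T, W i = 1) :
    Commute (tensorMatrix V) (tensorMatrix W) := by
  refine Commute.map (Pi.commute_iff.mpr fun i => ?_) tensorMatrix
  by_cases hi : i ∈ S
  · rw [hW i (hST.notMem_of_mem_left hi)]
    exact Commute.one_right _
  · rw [hV i hi]
    exact Commute.one_left _

theorem commute_of_mem_localAlgebra_of_disjoint (hST : Disjoint S T)
    {A B : Matrix (∀ i, κ i) (∀ i, κ i) R} (hA : A ∈ localAlgebra R S)
    (hB : B ∈ localAlgebra R T) : Commute A B := by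
  rw [localAlgebra] at hA hB
  refine Algebra.commute_of_mem_adjoin_of_forall_mem_commute hB ?_
  rintro _ ⟨W, hW, rfl⟩
  refine (Algebra.commute_of_mem_adjoin_of_forall_mem_commute hA ?_).symm
  rintro _ ⟨V, hV, rfl⟩
  exact (commute_tensorMatrix_of_disjoint hST hV hW).symm

theorem permMatrix_piCongrRight_mem_localAlgebra {σ : ∀ i, Equiv.Perm (κ i)}
    (hσ : ∀ i ∉ S, σ i = 1) :
    Equiv.Perm.permMatrix R (Equiv.piCongrRight σ) ∈ localAlgebra R S := by
  rw [← tensorMatrix_permMatrix]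
  refine tensorMatrix_mem_localAlgebra fun i hi => ?_
  rw [hσ i hi, Matrix.permMatrix_one]

variable (R) in
/-- The orthogonal projection onto the span of the basis states that agree with `p` on `T`. -/
def basisProjection (T : Finset ι) (p : ∀ i, κ i) : Matrix (∀ i, κ i) (∀ i, κ i) R :=
  Matrix.diagonal fun x => if ∀ i ∈ T, x i = p i then 1 else 0

theorem basisProjection_mem_localAlgebra (T : Finset ι) (p : ∀ i, κ i) :
    basisProjection R T p ∈ localAlgebra R (T : Set ι) := by
  have h : basisProjection R T p =
      tensorMatrix fun i => Matrix.diagonal fun c => if i ∈ T → c = p i then 1 else 0 := by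
    simp only [tensorMatrix_diagonal, Finset.prod_ite_zero, Finset.prod_const_one,
      basisProjection, Finset.mem_univ, forall_const]
  rw [h]
  refine tensorMatrix_mem_localAlgebra fun i hi => ?_
  simp [Finset.mem_coe.not.mp hi]

end CommSemiring

section LocalityPreserving

variable [CommRing R] [StarRing R] {S : Set ι}

variable (R) in
/-- The operators `U` whose conjugation `A ↦ U A U†` maps operators acting on `S` to operators
acting on `S`. -/
def localityPreserving (S : Set ι) : Submonoid (Matrix (∀ i, κ i) (∀ i, κ i) R) where
  carrier := {U | ∀ A ∈ localAlgebra R S, U * A * star U ∈ localAlgebra R S}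
  one_mem' A hA := by simpa using hA
  mul_mem' {U V} hU hV A hA := by
    simpa only [star_mul, mul_assoc] using hU _ (hV A hA)

theorem mem_localityPreserving_of_mem_localAlgebra {U : Matrix (∀ i, κ i) (∀ i, κ i) R}
    (hU : U ∈ localAlgebra R S) (hU' : star U ∈ localAlgebra R S) :
    U ∈ localityPreserving R S :=
  fun _ hA => mul_mem (mul_mem hU hA) hU'

theorem mem_localityPreserving_of_disjoint {T : Set ι} {U : Matrix (∀ i, κ i) (∀ i, κ i) R}
    (hU : U ∈ Matrix.unitaryGroup (∀ i, κ i) R) (hUT : U ∈ localAlgebra R T)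
    (hST : Disjoint S T) : U ∈ localityPreserving R S := by
  intro A hA
  rwa [← (commute_of_mem_localAlgebra_of_disjoint hST hA hUT).eq, mul_assoc,
    Matrix.mem_unitaryGroup_iff.mp hU, mul_one]

theorem tensorMatrix_mem_localityPreserving {U : ∀ i, Matrix (κ i) (κ i) R}
    (hU : ∀ i, U i ∈ Matrix.unitaryGroup (κ i) R) :
    tensorMatrix U ∈ localityPreserving R S := by
  let conj : Matrix (∀ i, κ i) (∀ i, κ i) R ≃⋆ₐ[R] Matrix (∀ i, κ i) (∀ i, κ i) R :=
    Unitary.conjStarAlgAut R _ ⟨tensorMatrix U, tensorMatrix_mem_unitaryGroup hU⟩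
  suffices h : localAlgebra R (κ := κ) S ≤ (localAlgebra R S).comap conj.toAlgEquiv.toAlgHom from
    fun A hA => h hA
  refine Algebra.adjoin_le ?_
  rintro _ ⟨V, hV, rfl⟩
  change tensorMatrix U * tensorMatrix V * star (tensorMatrix U) ∈ localAlgebra R S
  rw [star_tensorMatrix, ← map_mul, ← map_mul]
  refine tensorMatrix_mem_localAlgebra fun i hi => ?_
  simp only [Pi.mul_apply, Pi.star_apply, hV i hi, mul_one]
  exact Matrix.mem_unitaryGroup_iff.mp (hU i)

end LocalityPreserving

end LocalAlgebra

section Measurement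

variable {𝕜 : Type*} [RCLike 𝕜]

theorem sum_norm_sq_mulVec_of_mem_unitaryGroup {n : Type*} [Fintype n] [DecidableEq n]
    {U : Matrix n n 𝕜} (hU : U ∈ Matrix.unitaryGroup n 𝕜) (v : n → 𝕜) :
    ∑ z, ‖(U *ᵥ v) z‖ ^ 2 = ∑ z, ‖v z‖ ^ 2 := by
  have h (v : n → 𝕜) : ((∑ z, ‖v z‖ ^ 2 : ℝ) : 𝕜) = star v ⬝ᵥ v := by
    simp [dotProduct, RCLike.conj_mul]
  apply RCLike.ofReal_injective (K := 𝕜)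
  rw [h, h, Matrix.star_mulVec, Matrix.dotProduct_mulVec, Matrix.vecMul_vecMul,
    ← Matrix.star_eq_conjTranspose, Matrix.mem_unitaryGroup_iff'.mp hU, Matrix.vecMul_one]

variable {ι : Type*} [Fintype ι] [DecidableEq ι] {κ : ι → Type*} [∀ i, Fintype (κ i)]
  [∀ i, DecidableEq (κ i)]

theorem sum_norm_sq_basisProjection_mulVec (T : Finset ι) (p : ∀ i, κ i) (v : (∀ i, κ i) → 𝕜) :
    ∑ z, ‖(basisProjection 𝕜 T p *ᵥ v) z‖ ^ 2 = ∑ z with ∀ i ∈ T, z i = p i, ‖v z‖ ^ 2 := by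
  rw [Finset.sum_filter]
  refine Finset.sum_congr rfl fun z _ => ?_
  rw [basisProjection, Matrix.mulVec_diagonal]
  split_ifs <;> simp

theorem sum_norm_sq_mulVec_of_mem_localAlgebra {S : Set ι} {T : Finset ι}
    (hST : Disjoint S T) {U : Matrix (∀ i, κ i) (∀ i, κ i) 𝕜} (hUS : U ∈ localAlgebra 𝕜 S)
    (hU : U ∈ Matrix.unitaryGroup (∀ i, κ i) 𝕜) (p : ∀ i, κ i) (v : (∀ i, κ i) → 𝕜) :
    ∑ z with ∀ i ∈ T, z i = p i, ‖(U *ᵥ v) z‖ ^ 2 = ∑ z with ∀ i ∈ T, z i = p i, ‖v z‖ ^ 2 := by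
  have hcomm : Commute U (basisProjection 𝕜 T p) :=
    commute_of_mem_localAlgebra_of_disjoint hST hUS (basisProjection_mem_localAlgebra T p)
  rw [← sum_norm_sq_basisProjection_mulVec, ← sum_norm_sq_basisProjection_mulVec,
    Matrix.mulVec_mulVec, ← hcomm.eq, ← Matrix.mulVec_mulVec,
    sum_norm_sq_mulVec_of_mem_unitaryGroup hU]

end Measurement

section BitFlip

variable {ι : Type*} [DecidableEq ι]

/-- The permutation of the bit strings that flips the bit at position `i`. -/
def flipBit (i : ι) : Equiv.Perm (ι → Bool) :=
  Equiv.piCongrRight (Pi.mulSingle i Equiv.boolNot)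

theorem flipBit_apply_self (i : ι) (x : ι → Bool) : flipBit i x i = !x i := by
  simp [flipBit]

theorem flipBit_apply_of_ne {i j : ι} (h : j ≠ i) (x : ι → Bool) : flipBit i x j = x j := by
  simp [flipBit, h]

theorem flipBit_flipBit (i : ι) (x : ι → Bool) : flipBit i (flipBit i x) = x := by
  ext j
  obtain rfl | h := eq_or_ne j i
  · simp only [flipBit_apply_self, Bool.not_not]
  · simp only [flipBit_apply_of_ne h]

theorem permMatrix_mem_unitaryGroup {n R : Type*} [Fintype n] [DecidableEq n] [CommRing R]
    [StarRing R] (σ : Equiv.Perm n) : σ.permMatrix R ∈ Matrix.unitaryGroup n R := by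
  rw [Matrix.mem_unitaryGroup_iff, Matrix.star_eq_conjTranspose, Matrix.conjTranspose_permMatrix,
    ← Matrix.permMatrix_mul, inv_mul_cancel, Matrix.permMatrix_one]

variable [Fintype ι]

theorem permMatrix_flipBit_mem_localAlgebra {R : Type*} [CommSemiring R] (i : ι) :
    (flipBit i).permMatrix R ∈ localAlgebra R {i} :=
  permMatrix_piCongrRight_mem_localAlgebra fun _ hj => Pi.mulSingle_eq_of_ne hj _

theorem parity_flipBit (i : ι) (x : ι → Bool) : parity (flipBit i x) = !parity x := by
  have card_split (y : ι → Bool) : (Finset.univ.filter fun j => y j = true).card =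
      (y i).toNat + ((Finset.univ.erase i).filter fun j => y j = true).card := by
    rw [Finset.card_filter, Finset.card_filter, ← Finset.add_sum_erase _ _ (Finset.mem_univ i)]
    cases y i <;> simp
  have off_i : ((Finset.univ.erase i).filter fun j => flipBit i x j = true) =
      (Finset.univ.erase i).filter fun j => x j = true :=
    Finset.filter_congr fun j hj => by rw [flipBit_apply_of_ne (Finset.ne_of_mem_erase hj)]
  rw [parity, parity, card_split, card_split x, off_i, flipBit_apply_self]
  cases x i <;> simp [add_comm 1, Nat.odd_add_one, -Nat.not_odd_iff_even]

end BitFlip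

section InitialState

variable {Q : Type*} [DecidableEq Q] [Fintype Q] (I : Finset Q)
  (a : EuclideanSpace ℂ ({q // q ∉ I} → Bool))

theorem initialState_flipBit (i : {q // q ∈ I}) (x : {q // q ∈ I} → Bool) :
    initialState I a (flipBit i x) =
      (flipBit (i : Q)).permMatrix ℂ *ᵥ initialState I a x := by
  ext z
  have on_inputs : (fun q : {q // q ∈ I} => flipBit (i : Q) z q) =
      flipBit i fun q : {q // q ∈ I} => z q := by
    ext q
    obtain rfl | hq := eq_or_ne q i
    · simp only [flipBit_apply_self]
    · rw [flipBit_apply_of_ne hq, flipBit_apply_of_ne (Subtype.coe_injective.ne hq)]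
  have on_ancillas : (fun q : {q // q ∉ I} => flipBit (i : Q) z q) =
      fun q : {q // q ∉ I} => z q :=
    funext fun q => flipBit_apply_of_ne (fun h : (q : Q) = i => q.2 (h ▸ i.2)) z
  have flip_eq_iff (y : {q // q ∈ I} → Bool) : flipBit i y = x ↔ y = flipBit i x := by
    rw [← (flipBit i).apply_eq_iff_eq, flipBit_flipBit]
  rw [Matrix.permMatrix_mulVec, Function.comp_apply, initialState, initialState, on_inputs,
    on_ancillas]
  simp only [flip_eq_iff]

theorem sum_norm_sq_initialState (x : {q // q ∈ I} → Bool) :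
    ∑ z, ‖initialState I a x z‖ ^ 2 = ‖a‖ ^ 2 := by
  let e := Equiv.piEquivPiSubtypeProd (· ∈ I) fun _ => Bool
  have initialState_symm (y : {q // q ∈ I} → Bool) (y' : {q // q ∉ I} → Bool) :
      initialState I a x (e.symm (y, y')) = if y = x then a y' else 0 := by
    have hy : (fun q : {q // q ∈ I} => e.symm (y, y') q) = y :=
      congrArg Prod.fst (e.apply_symm_apply (y, y'))
    have hy' : (fun q : {q // q ∉ I} => e.symm (y, y') q) = y' :=
      congrArg Prod.snd (e.apply_symm_apply (y, y'))
    rw [initialState, hy, hy']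
  rw [← e.symm.sum_comp, Fintype.sum_prod_type, Fintype.sum_eq_single x, EuclideanSpace.norm_sq_eq]
  · simp only [initialState_symm, if_true]
  · intro y hy
    simp [initialState_symm, hy]

end InitialState

section CZLayer

variable {Q : Type*} [Fintype Q]

theorem singleLayerMatrix_eq_tensorMatrix [DecidableEq Q] (U : Q → Matrix.unitaryGroup Bool ℂ) :
    singleLayerMatrix U = tensorMatrix fun q => (U q : Matrix Bool Bool ℂ) := rfl

variable [DecidableEq Q]

theorem singleLayerMatrix_mem_unitaryGroup (U : Q → Matrix.unitaryGroup Bool ℂ) :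
    singleLayerMatrix U ∈ Matrix.unitaryGroup (Q → Bool) ℂ := by
  rw [singleLayerMatrix_eq_tensorMatrix]
  exact tensorMatrix_mem_unitaryGroup fun q => (U q).2

theorem singleLayerMatrix_mem_localityPreserving (U : Q → Matrix.unitaryGroup Bool ℂ)
    (S : Set Q) : singleLayerMatrix U ∈ localityPreserving ℂ S := by
  rw [singleLayerMatrix_eq_tensorMatrix]
  exact tensorMatrix_mem_localityPreserving fun q => (U q).2

theorem czMatrix_eq_one_sub_basisProjection (T : Finset Q) :
    czMatrix T = 1 - (2 : ℂ) • basisProjection ℂ T fun _ => true := by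
  rw [czMatrix, basisProjection, ← Matrix.diagonal_one, ← Matrix.diagonal_smul,
    Matrix.diagonal_sub]
  congr 1 with x
  simp only [czPhase, Pi.smul_apply, smul_eq_mul]
  split_ifs <;> norm_num

theorem czMatrix_mem_localAlgebra (T : Finset Q) :
    czMatrix T ∈ localAlgebra ℂ (T : Set Q) := by
  rw [czMatrix_eq_one_sub_basisProjection]
  exact sub_mem (one_mem _) (Subalgebra.smul_mem _ (basisProjection_mem_localAlgebra T _) 2)

theorem star_czMatrix (T : Finset Q) : star (czMatrix T) = czMatrix T := by
  rw [czMatrix, Matrix.star_eq_conjTranspose, Matrix.diagonal_conjTranspose]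
  congr 1 with x
  rw [Pi.star_apply, czPhase]
  split_ifs <;> simp

theorem czMatrix_mem_unitaryGroup (T : Finset Q) :
    czMatrix T ∈ Matrix.unitaryGroup (Q → Bool) ℂ := by
  rw [Matrix.mem_unitaryGroup_iff, star_czMatrix, czMatrix, Matrix.diagonal_mul_diagonal,
    ← Matrix.diagonal_one]
  congr 1 with x
  rw [czPhase]
  split_ifs <;> simp

theorem czMatrix_mem_localityPreserving {T : Finset Q} {S : Set Q}
    (h : (T : Set Q) ⊆ S ∨ Disjoint S T) : czMatrix T ∈ localityPreserving ℂ S := by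
  rcases h with hTS | hST
  · have hT := localAlgebra_mono hTS (czMatrix_mem_localAlgebra T)
    exact mem_localityPreserving_of_mem_localAlgebra hT (by rwa [star_czMatrix])
  · exact mem_localityPreserving_of_disjoint (czMatrix_mem_unitaryGroup T)
      (czMatrix_mem_localAlgebra T) hST

theorem czLayerMatrix_mem_of_forall_czMatrix_mem {M : CZLayer Q}
    {N : Submonoid (Matrix (Q → Bool) (Q → Bool) ℂ)} (h : ∀ T ∈ M.gates, czMatrix T ∈ N) :
    czLayerMatrix M ∈ N := by
  rw [czLayerMatrix_eq_prod]
  exact Submonoid.list_prod_mem _ (by simpa using h)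

theorem czLayerMatrix_mem_unitaryGroup (M : CZLayer Q) :
    czLayerMatrix M ∈ Matrix.unitaryGroup (Q → Bool) ℂ :=
  czLayerMatrix_mem_of_forall_czMatrix_mem fun T _ => czMatrix_mem_unitaryGroup T

end CZLayer

theorem CZLayer.gate_eq_of_mem {Q : Type*} (M : CZLayer Q) {T T' : Finset Q} (hT : T ∈ M.gates)
    (hT' : T' ∈ M.gates) {q : Q} (hq : q ∈ T) (hq' : q ∈ T') : T = T' :=
  M.pairwiseDisjoint.elim_finset hT hT' q hq hq'

namespace QACCircuit

variable {Q : Type*} {d : ℕ}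

section LightCone

variable {C : QACCircuit Q d} {i j : Q}

theorem forwardLightCone_zero : C.forwardLightCone 0 i = {i} := by
  ext j
  constructor
  · rintro ⟨p, hp₀, hpj, -⟩
    exact hpj.symm.trans hp₀
  · rintro rfl
    exact ⟨fun _ => j, rfl, rfl, fun k hk => absurd hk (Fin.not_lt_zero _)⟩

theorem mem_forwardLightCone_succ {k : Fin d} :
    j ∈ C.forwardLightCone k.succ i ↔
      ∃ j' ∈ C.forwardLightCone k.castSucc i, C.SameGate k j' j := by
  constructor
  · rintro ⟨p, hp₀, rfl, hp⟩
    exact ⟨p k.castSucc, ⟨p, hp₀, rfl, fun l hl => hp l (hl.trans k.castSucc_lt_succ)⟩,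
      hp k k.castSucc_lt_succ⟩
  · rintro ⟨_, ⟨p, hp₀, rfl, hp⟩, hj⟩
    refine ⟨fun l => if l ≤ k.castSucc then p l else j, by simpa using hp₀,
      by simp [Fin.le_def], fun l hl => ?_⟩
    rw [Fin.castSucc_lt_succ_iff] at hl
    beta_reduce
    rw [if_pos (Fin.castSucc_le_castSucc_iff.mpr hl)]
    rcases hl.lt_or_eq with hlk | rfl
    · rw [if_pos (Fin.le_def.mpr (Nat.succ_le_of_lt hlk))]
      exact hp l (Fin.castSucc_lt_castSucc_iff.mpr hlk)
    · rwa [if_neg (by simp [Fin.le_def])]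

theorem forwardLightCone_castSucc_subset_succ (k : Fin d) :
    C.forwardLightCone k.castSucc i ⊆ C.forwardLightCone k.succ i :=
  fun j hj => mem_forwardLightCone_succ.mpr ⟨j, hj, .inl rfl⟩

theorem mem_forwardLightCone_succ_of_mem_gate {k : Fin d} {T : Finset Q}
    (hT : T ∈ (C.cz k).gates) (hj : j ∈ T) :
    j ∈ C.forwardLightCone k.succ i ↔
      (C.forwardLightCone k.castSucc i ∩ (T : Set Q)).Nonempty := by
  rw [mem_forwardLightCone_succ]
  constructor
  · rintro ⟨j', hj', rfl | ⟨T', hT', hj'T', hjT'⟩⟩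
    · exact ⟨j', hj', hj⟩
    · obtain rfl := (C.cz k).gate_eq_of_mem hT hT' hj hjT'
      exact ⟨j', hj', hj'T'⟩
  · rintro ⟨j', hj', hj'T⟩
    exact ⟨j', hj', .inr ⟨T, hT, hj'T, hj⟩⟩

theorem mem_forwardLightCone_succ_of_forall_notMem_gate {k : Fin d}
    (hj : ∀ T ∈ (C.cz k).gates, j ∉ T) :
    j ∈ C.forwardLightCone k.succ i ↔ j ∈ C.forwardLightCone k.castSucc i := by
  refine ⟨fun h => ?_, fun h => forwardLightCone_castSucc_subset_succ k h⟩
  obtain ⟨j', hj', rfl | ⟨T, hT, -, hjT⟩⟩ := mem_forwardLightCone_succ.mp h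
  · exact hj'
  · exact absurd hjT (hj T hT)

theorem gate_subset_or_disjoint_forwardLightCone_succ {k : Fin d} {T : Finset Q}
    (hT : T ∈ (C.cz k).gates) (i : Q) :
    (T : Set Q) ⊆ C.forwardLightCone k.succ i ∨ Disjoint (C.forwardLightCone k.succ i) T := by
  by_cases h : (C.forwardLightCone k.castSucc i ∩ (T : Set Q)).Nonempty
  · exact .inl fun j hj => (mem_forwardLightCone_succ_of_mem_gate hT hj).mpr h
  · exact .inr <| Set.disjoint_right.mpr fun j hj hj' =>
      h ((mem_forwardLightCone_succ_of_mem_gate hT hj).mp hj')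

theorem exists_disjoint_of_weight_lt_card {I : Finset Q} {k : Fin d} {T : Finset Q}
    (h : C.weight I k T < I.card) :
    ∃ i ∈ I, ¬ (C.forwardLightCone k.castSucc i ∩ (T : Set Q)).Nonempty := by
  by_contra! hall
  have hweight : C.weight I k T = I.card := by
    rw [weight, ← Set.ncard_coe_finset]
    exact congrArg Set.ncard (Set.ext fun i => ⟨And.left, fun hi => ⟨hi, hall i hi⟩⟩)
  exact h.ne hweight

theorem exists_mem_inputs_notMem_forwardLightCone {I : Finset Q} (hI : 1 < I.card)
    (hweight : ∀ k, ∀ T ∈ (C.cz k).gates, C.weight I k T < I.card) (t : Fin (d + 1)) (o : Q) :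
    ∃ i ∈ I, o ∉ C.forwardLightCone t i := by
  induction t using Fin.induction with
  | zero =>
    obtain ⟨i, hi, hio⟩ := Finset.exists_mem_ne hI o
    exact ⟨i, hi, by simpa [forwardLightCone_zero] using hio.symm⟩
  | succ k ih =>
    by_cases hgate : ∃ T ∈ (C.cz k).gates, o ∈ T
    · obtain ⟨T, hT, ho⟩ := hgate
      obtain ⟨i, hi, hdisj⟩ := exists_disjoint_of_weight_lt_card (hweight k T hT)
      exact ⟨i, hi, mt (mem_forwardLightCone_succ_of_mem_gate hT ho).mp hdisj⟩
    · push Not at hgate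
      obtain ⟨i, hi, ho⟩ := ih
      exact ⟨i, hi, mt (mem_forwardLightCone_succ_of_forall_notMem_gate hgate).mp ho⟩

end LightCone

variable [DecidableEq Q] [Fintype Q]

theorem prefixUnitary_zero (C : QACCircuit Q d) :
    C.prefixUnitary 0 = singleLayerMatrix (C.single 0) := rfl

theorem prefixUnitary_succ (C : QACCircuit Q d) (k : Fin d) :
    C.prefixUnitary k.succ =
      singleLayerMatrix (C.single k.succ) * czLayerMatrix (C.cz k) * C.prefixUnitary k.castSucc :=
  rfl

theorem prefixUnitary_mem_unitaryGroup (C : QACCircuit Q d) (t : Fin (d + 1)) :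
    C.prefixUnitary t ∈ Matrix.unitaryGroup (Q → Bool) ℂ := by
  induction t using Fin.induction with
  | zero =>
    rw [prefixUnitary_zero]
    exact singleLayerMatrix_mem_unitaryGroup _
  | succ k ih =>
    rw [prefixUnitary_succ]
    exact mul_mem (mul_mem (singleLayerMatrix_mem_unitaryGroup _)
      (czLayerMatrix_mem_unitaryGroup _)) ih

theorem conj_prefixUnitary_mem_localAlgebra (C : QACCircuit Q d) {i : Q}
    {A : Matrix (Q → Bool) (Q → Bool) ℂ} (hA : A ∈ localAlgebra ℂ {i}) (t : Fin (d + 1)) :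
    C.prefixUnitary t * A * star (C.prefixUnitary t) ∈
      localAlgebra ℂ (C.forwardLightCone t i) := by
  induction t using Fin.induction with
  | zero =>
    rw [forwardLightCone_zero, prefixUnitary_zero]
    exact singleLayerMatrix_mem_localityPreserving _ _ A hA
  | succ k ih =>
    have layer_mem : singleLayerMatrix (C.single k.succ) * czLayerMatrix (C.cz k) ∈
        localityPreserving ℂ (C.forwardLightCone k.succ i) :=
      mul_mem (singleLayerMatrix_mem_localityPreserving _ _)
        (czLayerMatrix_mem_of_forall_czMatrix_mem fun T hT =>
          czMatrix_mem_localityPreserving (gate_subset_or_disjoint_forwardLightCone_succ hT i))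
    have := layer_mem _ (localAlgebra_mono (forwardLightCone_castSucc_subset_succ k) ih)
    simpa only [prefixUnitary_succ, star_mul, mul_assoc] using this

section Output

variable (C : QACCircuit Q d) (I : Finset Q) (a : EuclideanSpace ℂ ({q // q ∉ I} → Bool)) {o : Q}

theorem outputProb_flipBit_of_notMem_forwardLightCone {i : {q // q ∈ I}}
    (ho : o ∉ C.forwardLightCone (Fin.last d) i) (x : {q // q ∈ I} → Bool) (b : Bool) :
    C.outputProb I a o (flipBit i x) b = C.outputProb I a o x b := by
  let X : Matrix (Q → Bool) (Q → Bool) ℂ := (flipBit (i : Q)).permMatrix ℂ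
  have hC : C.unitary ∈ Matrix.unitaryGroup (Q → Bool) ℂ := C.prefixUnitary_mem_unitaryGroup _
  have hX : X ∈ Matrix.unitaryGroup (Q → Bool) ℂ := permMatrix_mem_unitaryGroup _
  have flip_after : C.unitary *ᵥ initialState I a (flipBit i x) =
      (C.unitary * X * star C.unitary) *ᵥ (C.unitary *ᵥ initialState I a x) := by
    rw [initialState_flipBit, Matrix.mulVec_mulVec, Matrix.mulVec_mulVec, mul_assoc _ (star _),
      Matrix.mem_unitaryGroup_iff'.mp hC, mul_one]
  have hlocal : C.unitary * X * star C.unitary ∈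
      localAlgebra ℂ (C.forwardLightCone (Fin.last d) i) :=
    C.conj_prefixUnitary_mem_localAlgebra (permMatrix_flipBit_mem_localAlgebra (i : Q)) _
  have hunitary : C.unitary * X * star C.unitary ∈ Matrix.unitaryGroup (Q → Bool) ℂ :=
    mul_mem (mul_mem hC hX) (Unitary.star_mem hC)
  have hdisj : Disjoint (C.forwardLightCone (Fin.last d) i) (({o} : Finset Q) : Set Q) := by
    simpa using ho
  have same_prob := sum_norm_sq_mulVec_of_mem_localAlgebra hdisj hlocal hunitary (fun _ => b)
    (C.unitary *ᵥ initialState I a x)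
  simp only [Finset.mem_singleton, forall_eq] at same_prob
  rw [outputProb, outputProb, flip_after, same_prob]

theorem outputProb_add_outputProb_not (o : Q) (x : {q // q ∈ I} → Bool) (b : Bool) :
    C.outputProb I a o x b + C.outputProb I a o x (!b) = ‖a‖ ^ 2 := by
  simp only [outputProb, Bool.eq_not]
  rw [Finset.sum_filter_add_sum_filter_not, unitary,
    sum_norm_sq_mulVec_of_mem_unitaryGroup (C.prefixUnitary_mem_unitaryGroup _),
    sum_norm_sq_initialState]

theorem paritySuccessProb_of_notMem_forwardLightCone {i : Q} (hi : i ∈ I)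
    (ho : o ∉ C.forwardLightCone (Fin.last d) i) :
    C.paritySuccessProb I a o = ‖a‖ ^ 2 / 2 := by
  let success (x : {q // q ∈ I} → Bool) : ℝ := C.outputProb I a o x (parity x)
  let flip : Equiv.Perm ({q // q ∈ I} → Bool) := flipBit ⟨i, hi⟩
  have success_add_flip (x) : success x + success (flip x) = ‖a‖ ^ 2 := by
    simp only [success, flip]
    rw [parity_flipBit, C.outputProb_flipBit_of_notMem_forwardLightCone I a ho,
      C.outputProb_add_outputProb_not I a]
  have two_mul_sum : 2 * ∑ x, success x = 2 ^ I.card * ‖a‖ ^ 2 := calc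
    2 * ∑ x, success x = ∑ x, success x + ∑ x, success (flip x) := by
      rw [Equiv.sum_comp flip success, two_mul]
    _ = ∑ x, (success x + success (flip x)) := Finset.sum_add_distrib.symm
    _ = 2 ^ I.card * ‖a‖ ^ 2 := by simp [success_add_flip]
  rw [paritySuccessProb, div_eq_div_iff (by positivity) two_ne_zero]
  linarith

end Output

end QACCircuit

theorem mainTheorem11_general {Q : Type*} [DecidableEq Q] [Fintype Q] {d : ℕ}
    (C : QACCircuit Q d) (I : Finset Q) (hI : 1 < I.card)
    (a : EuclideanSpace ℂ ({q // q ∉ I} → Bool)) (ha : ‖a‖ = 1) (o : Q)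
    (hweight : ∀ k, ∀ T ∈ (C.cz k).gates, C.weight I k T < I.card) :
    C.paritySuccessProb I a o = 1 / 2 := by
  obtain ⟨i, hi, ho⟩ :=
    QACCircuit.exists_mem_inputs_notMem_forwardLightCone hI hweight (Fin.last d) o
  rw [C.paritySuccessProb_of_notMem_forwardLightCone I a hi ho, ha, one_pow]

theorem rpow_one_div_natCast_le_self {x : ℝ} (hx : 1 ≤ x) {d : ℕ} (hd : 1 ≤ d) :
    x ^ (1 / (d : ℝ)) ≤ x :=
  Real.rpow_le_self_of_one_le hx (div_le_self zero_le_one (Nat.one_le_cast.mpr hd))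

theorem le_two_mul_pow_mul_pow {s w : ℕ} (hs : 1 ≤ s) (hw : 1 ≤ w) (e : ℕ) :
    (s : ℝ) ≤ (2 * (s : ℝ)) ^ w * (2 * (w : ℝ) + 1) ^ e := by
  have hs' : (1 : ℝ) ≤ s := Nat.one_le_cast.mpr hs
  calc (s : ℝ) ≤ 2 * s := by linarith
    _ ≤ (2 * (s : ℝ)) ^ w := le_self_pow₀ (by linarith) (Nat.one_le_iff_ne_zero.mp hw)
    _ ≤ (2 * (s : ℝ)) ^ w * (2 * (w : ℝ) + 1) ^ e :=
      le_mul_of_one_le_right (by positivity) (one_le_pow₀ (by linarith [w.cast_nonneg (α := ℝ)]))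

theorem mainTheorem11 (n w m s d : ℕ) (hn : 1 ≤ n) (hw : 1 ≤ w) (hs : 3 ≤ s) (hd : 1 ≤ d)
    (C : QACCircuit (Fin w × Fin m) d) (hC : C.Is2D)
    (I : Finset (Fin w × Fin m)) (hI : I.card = n)
    (a : EuclideanSpace ℂ ({q // q ∉ I} → Bool)) (ha : ‖a‖ = 1)
    (o : Fin w × Fin m)
    (hweight : ∀ k, ∀ T ∈ (C.cz k).gates, C.weight I k T ≤ s)
    (hbound : (2 * (s : ℝ)) ^ w * (2 * (w : ℝ) + 1) ^ (w * (w - 1) / 2)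
      < (n : ℝ) ^ (1 / (d : ℝ))) :
    C.paritySuccessProb I a o = 1 / 2 := by
  have hsn : s < n := by
    have : (s : ℝ) < n := (le_two_mul_pow_mul_pow (by omega) hw _).trans_lt
      (hbound.trans_le (rpow_one_div_natCast_le_self (Nat.one_le_cast.mpr hn) hd))
    exact_mod_cast this
  subst hI
  exact mainTheorem11_general C I (by omega) a ha o fun k T hT => (hweight k T hT).trans_lt hsn
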